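/- Let $p$ be a prime and let $G$ be a finite nonabelian $p$-group with Frattini subgroup $\Phi(G)$. The quotient $G/\Phi(G)$ acts by conjugation on the abelian group $Z(\Phi(G))$, the center of $\Phi(G)$. Call $G$ an S-group if the Tate cohomology group $\hat{H}^0(G/\Phi(G);Z(\Phi(G)))$ is nonzero, and an NS-group otherwise. Let $d(G)$ denote the minimum number of generators of $G$. (i) If $G$ is an NS-group with $d(G)=m$, then $|\Phi(G)|\ge p^{m+p+2}$ and $|G|\ge p^{2m+p+2}$. (ii) If $|\Phi(G)|<p^{p+4}$ or $|G|<p^{p+6}$, then $G$ is an S-group. -/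

import Mathlib

open scoped IsMulCommutative

universe u

/-- The conjugation action of `G` on the center `Z(Φ(G))` of its Frattini subgroup:
`g` sends `a` to `g a g⁻¹`. -/
def conjCenterFrattini (G : Type u) [Group G] :
    G →* MulAut (Subgroup.center (frattini G)) where
  toFun g := Subgroup.centerCongr (MulAut.conjNormal g : MulAut (frattini G))
  map_one' := by
    ext a
    exact congrArg Subtype.val (congrArg (fun f : MulAut (frattini G) => f a.1)
      (map_one (MulAut.conjNormal : G →* MulAut (frattini G))))
  map_mul' g h := by
    ext a
    exact congrArg Subtype.val (congrArg (fun f : MulAut (frattini G) => f a.1)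
      (map_mul (MulAut.conjNormal : G →* MulAut (frattini G)) g h))

theorem conjCenterFrattini_apply (G : Type u) [Group G] (g : G)
    (a : Subgroup.center (frattini G)) :
    ((conjCenterFrattini G g a : frattini G) : G) = g * ((a : frattini G) : G) * g⁻¹ :=
  MulAut.conjNormal_apply g a.1

/-- The Frattini subgroup acts trivially on its own center. -/
theorem frattini_le_ker_conjCenterFrattini (G : Type u) [Group G] :
    frattini G ≤ (conjCenterFrattini G).ker := by
  intro g hg
  rw [MonoidHom.mem_ker]
  ext a
  have h := congrArg Subtype.val ((Subgroup.mem_center_iff.mp a.2) ⟨g, hg⟩)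
  simp only [Subgroup.coe_mul] at h
  rw [conjCenterFrattini_apply, h]
  simp

/-- The conjugation action of the Frattini quotient `G/Φ(G)` on `Z(Φ(G))`. -/
def frattiniQuotientAction (G : Type u) [Group G] :
    G ⧸ frattini G →* MulAut (Subgroup.center (frattini G)) :=
  QuotientGroup.lift (frattini G) (conjCenterFrattini G) (frattini_le_ker_conjCenterFrattini G)

/-- `Z(Φ(G))`, written additively, as a `ℤ[G/Φ(G)]`-module through the conjugation action.
(`ULift ℤ` is the ring of integers placed in the universe of `G`.) -/
def centerFrattiniRep (G : Type u) [Group G] :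
    Representation (ULift.{u} ℤ) (G ⧸ frattini G)
      (Additive (Subgroup.center (frattini G))) where
  toFun q :=
    { toFun := fun a => Additive.ofMul (frattiniQuotientAction G q a.toMul)
      map_add' := fun a b => by simp
      map_smul' := fun n a => by
        change Additive.ofMul (frattiniQuotientAction G q (a.toMul ^ n.down)) =
          Additive.ofMul ((frattiniQuotientAction G q a.toMul) ^ n.down)
        rw [map_zpow] }
  map_one' := by
    ext a
    simp
  map_mul' q r := by
    ext a
    simp

open Classical in
/-- The Tate cohomology group `Ĥ⁰(G/Φ(G); Z(Φ(G)))`. -/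
noncomputable def tateZero (G : Type u) [Group G] [Finite G] : ModuleCat.{u} (ULift.{u} ℤ) :=
  letI : Fintype (G ⧸ frattini G) := Fintype.ofFinite _
  tateCohomology (Rep.of (centerFrattiniRep G)) 0

/-- A finite nonabelian `p`-group `G` is an S-group if `Ĥ⁰(G/Φ(G); Z(Φ(G))) ≠ 0`. -/
def IsSGroup (p : ℕ) (G : Type u) [Group G] [Finite G] : Prop :=
  IsPGroup p G ∧ (∃ a b : G, a * b ≠ b * a) ∧ Nontrivial (tateZero G)

/-- A finite nonabelian `p`-group is an NS-group if it is not an S-group. -/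
def IsNSGroup (p : ℕ) (G : Type u) [Group G] [Finite G] : Prop :=
  IsPGroup p G ∧ (∃ a b : G, a * b ≠ b * a) ∧ ¬ IsSGroup p G

/-!
Let `Q = G/Φ(G)`, an elementary abelian group of order `p ^ d`, and `A = Z(Φ(G))`. The theorem
follows from two facts about an NS-group: `|A| ≥ p ^ (d + p)`, and `Φ(G)` is not abelian, so that
`|Φ(G)| ≥ p ^ 2 |A|`. Moreover `rank G ≤ d`, because a basis of `Q` lifts to generators of `G`, and
`d ≥ 2` because `G` is not cyclic.

Write `N(x) = 1 + x + ⋯ + x ^ (p - 1)`. For a basis `x₁, …, x_d` of `Q` the norm of `Q` is the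
product of the `N(xᵢ)`, and the vanishing of Tate cohomology in degree `0` says that the elements
of `A` fixed by all the `xᵢ` are norms (`FixedAreNorms`). All arguments take place over the
commutative ring of endomorphisms of `A` generated by `Q`, in which `p` and all `x - 1` are
nilpotent.

*The order of `A`.* If `d > 2`, the property passes to the invariants of one `xᵢ` and the remaining
basis elements; the invariants are a proper submodule, so each step contributes a factor `p`. For
`d = 2` with basis `x, y`, consider the chain of submodules of `A` cut out by the partial products
of the `y - x ^ j`, `0 ≤ j < p`. The full product is a unit times `N(x) (y - 1)`
(`prod_sub_pow_eq_normElt_mul_unit`), and it does not kill `A`, since `y` acts nontrivially on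
`N(x) A`. So all `p` steps of the chain are proper and the last term is nonzero; the first step has
the order of the invariants of `y`, which is at least `p ^ 2`. Altogether `|A| ≥ p ^ (p + 2)`
(`FixedAreNorms.card_ge_of_pair`).

*`Φ(G)` is not abelian.* Counting as for the Herbrand quotient, together with Nakayama's lemma,
shows that the vanishing descends to smaller parts of the basis (`FixedAreNorms.of_cons`), and for
a single `x` it gives `ker N(x) = im (x - 1)` as well. If `Φ(G)` were abelian, then `x` would have
a lift `w` of order `p` to `G`, and all conjugates of `w` would be conjugate under `Φ(G)`. So
`G = Φ(G) C(w)`, hence `w` is central, although `x` acts nontrivially on `A`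
(`IsPGroup.frattini_not_commutative`).
-/

/-! ### Unipotent elements and norm elements -/

/-- If `p` is nilpotent, then `x ^ p = 1` makes `x` unipotent, because `(x - 1) ^ p ∈ p R`. -/
theorem isNilpotent_sub_one_of_pow_prime_eq_one {R : Type*} [CommRing R] {p : ℕ}
    (hp : p.Prime) (hR : IsNilpotent (p : R)) {x : R} (hx : x ^ p = 1) :
    IsNilpotent (x - 1) := by
  obtain ⟨r, hr⟩ := exists_add_pow_prime_eq hp (x - 1) 1
  have h : (x - 1) ^ p = (p : R) * -((x - 1) * r) := by
    rw [sub_add_cancel, hx, one_pow] at hr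
    linear_combination -hr
  have h2 : IsNilpotent ((x - 1) ^ p) := by
    rw [h]
    exact (Commute.all _ _).isNilpotent_mul_right hR
  exact (IsNilpotent.pow_iff_pos hp.ne_zero).mp h2

/-- The norm element `1 + x + ⋯ + x ^ (p - 1)` of an element `x` with `x ^ p = 1`. -/
def normElt {R : Type*} [CommRing R] (p : ℕ) (x : R) : R := ∑ i ∈ Finset.range p, x ^ i

theorem sub_one_mul_normElt {R : Type*} [CommRing R] {p : ℕ} {x : R} (hx : x ^ p = 1) :
    (x - 1) * normElt p x = 0 := by
  rw [normElt, mul_comm, geom_sum_mul, hx, sub_self]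

theorem normElt_smul_of_smul_eq {R M : Type*} [CommRing R] [AddCommGroup M] [Module R M] (p : ℕ)
    {x : R} {m : M} (h : x • m = m) : normElt p x • m = (p : R) • m := by
  have hi : ∀ i : ℕ, x ^ i • m = m := fun i => by
    induction i with
    | zero => simp
    | succ k ih => rw [pow_succ, mul_smul, h, ih]
  simp [normElt, Finset.sum_smul, hi, Nat.cast_smul_eq_nsmul]

/-! ### Finite modules over a ring in which `p` is nilpotent -/

section Pointwise
open scoped Pointwise

variable {R M : Type*} [CommRing R] [AddCommGroup M] [Module R M]

/-- Nakayama's lemma for a nilpotent element. -/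
theorem Submodule.le_of_le_sup_smul_of_isNilpotent {t : R} (ht : IsNilpotent t)
    {B C : Submodule R M} (h : B ≤ C ⊔ t • B) : B ≤ C := by
  obtain ⟨n, hn⟩ := ht
  have key : ∀ k : ℕ, B ≤ C ⊔ t ^ k • B := fun k => by
    induction k with
    | zero => simp
    | succ k ih =>
      intro b hb
      obtain ⟨c, hc, d, hd, rfl⟩ := Submodule.mem_sup.mp (ih hb)
      obtain ⟨b', hb', rfl⟩ := (Submodule.mem_smul_pointwise_iff_exists _ _ _).mp hd
      obtain ⟨c', hc', d', hd', rfl⟩ := Submodule.mem_sup.mp (h hb')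
      obtain ⟨e, he, rfl⟩ := (Submodule.mem_smul_pointwise_iff_exists _ _ _).mp hd'
      rw [smul_add, ← add_assoc, ← mul_smul, ← pow_succ]
      exact Submodule.add_mem_sup (C.add_mem hc (C.smul_mem _ hc'))
        (Submodule.smul_mem_pointwise_smul _ _ _ he)
  simpa [hn] using key n

theorem Submodule.eq_bot_of_le_smul_of_isNilpotent {t : R} (ht : IsNilpotent t)
    {B : Submodule R M} (h : B ≤ t • B) : B = ⊥ :=
  le_bot_iff.mp (Submodule.le_of_le_sup_smul_of_isNilpotent ht (by simpa using h))

theorem Submodule.smul_pointwise_le (t : R) (B : Submodule R M) : t • B ≤ B := by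
  intro b hb
  obtain ⟨c, hc, rfl⟩ := (Submodule.mem_smul_pointwise_iff_exists _ _ _).mp hb
  exact B.smul_mem _ hc

theorem Submodule.smul_lt_of_isNilpotent {t : R} (ht : IsNilpotent t)
    {B : Submodule R M} (h : B ≠ ⊥) : t • B < B :=
  lt_of_le_of_ne (B.smul_pointwise_le t)
    fun h' => h (Submodule.eq_bot_of_le_smul_of_isNilpotent ht h'.ge)

theorem Submodule.smul_ne_bot_iff {t : R} {B : Submodule R M} :
    t • B ≠ ⊥ ↔ ∃ b ∈ B, t • b ≠ 0 := by
  rw [Submodule.ne_bot_iff]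
  simp only [Submodule.mem_smul_pointwise_iff_exists]
  constructor
  · rintro ⟨_, ⟨b, hb, rfl⟩, h⟩
    exact ⟨b, hb, h⟩
  · rintro ⟨b, hb, h⟩
    exact ⟨_, ⟨b, hb, rfl⟩, h⟩

/-- A nilpotent element kills some nonzero element of a nontrivial module. -/
theorem exists_ne_zero_smul_eq_zero_of_isNilpotent {t : R} (ht : IsNilpotent t)
    {B : Submodule R M} (h : B ≠ ⊥) : ∃ b ∈ B, b ≠ 0 ∧ t • b = 0 := by
  by_contra! hc
  obtain ⟨n, hn⟩ := ht
  obtain ⟨b, hb, hb0⟩ := (Submodule.ne_bot_iff B).mp h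
  have key : ∀ k : ℕ, t ^ k • b ≠ 0 := fun k => by
    induction k with
    | zero => simpa
    | succ k ih =>
      rw [pow_succ', mul_smul]
      exact hc _ (B.smul_mem _ hb) ih
  exact key n (by simp [hn])

/-- If `p` is nilpotent on a finite module, strict inclusions of submodules multiply the
order by at least `p`. -/
theorem Submodule.prime_mul_card_le_of_lt [Finite M] {p : ℕ} [Fact p.Prime]
    (hR : IsNilpotent (p : R)) {B C : Submodule R M} (h : B < C) :
    p * Nat.card B ≤ Nat.card C := by
  have hP : IsPGroup p (Multiplicative M) := by
    obtain ⟨n, hn⟩ := hR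
    intro g
    refine ⟨n, ?_⟩
    apply Multiplicative.toAdd.injective
    change p ^ n • g.toAdd = 0
    rw [← Nat.cast_smul_eq_nsmul R, Nat.cast_pow, hn, zero_smul]
  have hcard : ∀ D : Submodule R M, ∃ n, Nat.card D = p ^ n := fun D =>
    (IsPGroup.iff_card (G := AddSubgroup.toSubgroup D.toAddSubgroup)).mp
      (hP.to_subgroup (AddSubgroup.toSubgroup D.toAddSubgroup))
  obtain ⟨b, hb⟩ := hcard B
  obtain ⟨c, hc⟩ := hcard C
  have hlt : Nat.card B < Nat.card C := Set.ncard_lt_ncard h (Set.toFinite _)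
  rw [hb, hc] at hlt ⊢
  have := (Nat.pow_lt_pow_iff_right (Fact.out : p.Prime).one_lt).mp hlt
  rw [← pow_succ']
  exact Nat.pow_le_pow_right (Fact.out : p.Prime).pos this

theorem card_torsionBy_mul_card_smul_top (t : R) :
    Nat.card (Submodule.torsionBy R M t) * Nat.card (t • (⊤ : Submodule R M) : Submodule R M) =
      Nat.card M := by
  have h := Submodule.card_eq_card_quotient_mul_card (LinearMap.ker (LinearMap.lsmul R M t))
  rw [Nat.card_congr (LinearMap.lsmul R M t).quotKerEquivRange.toEquiv, mul_comm] at h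
  rw [h, mul_comm, LinearMap.range_eq_map]
  rfl

/-- Herbrand-quotient counting for an element `x` with `x ^ p = 1`: if the invariants of `x` are
norms of elements of a submodule `C`, then `C` is everything and every element of norm zero is
in the image of `x - 1`. -/
theorem eq_top_and_mem_smul_of_norm_surjOn [Finite M] {p : ℕ} (hp : p.Prime)
    (hR : IsNilpotent (p : R)) {x : R} (hx : x ^ p = 1) {C : Submodule R M}
    (hC : ∀ m : M, x • m = m → ∃ c ∈ C, normElt p x • c = m) :
    C = ⊤ ∧ ∀ m : M, normElt p x • m = 0 → ∃ n : M, (x - 1) • n = m := by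
  set t := x - 1
  set N := normElt p x
  have htN : t * N = 0 := sub_one_mul_normElt hx
  have hker : Submodule.torsionBy R M t = N • (⊤ : Submodule R M) := by
    apply le_antisymm
    · intro m hm
      rw [Submodule.mem_torsionBy_iff, sub_smul, one_smul, sub_eq_zero] at hm
      obtain ⟨c, -, rfl⟩ := hC m hm
      exact Submodule.smul_mem_pointwise_smul _ _ _ trivial
    · intro m hm
      obtain ⟨c, -, rfl⟩ := (Submodule.mem_smul_pointwise_iff_exists _ _ _).mp hm
      rw [Submodule.mem_torsionBy_iff, ← mul_smul, htN, zero_smul]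
  -- `ker t` and `im N` agree, so `im t` and `ker N` have the same order.
  have him : t • (⊤ : Submodule R M) = Submodule.torsionBy R M N := by
    have hle : t • (⊤ : Submodule R M) ≤ Submodule.torsionBy R M N := by
      intro m hm
      obtain ⟨c, -, rfl⟩ := (Submodule.mem_smul_pointwise_iff_exists _ _ _).mp hm
      rw [Submodule.mem_torsionBy_iff, ← mul_smul, mul_comm, htN, zero_smul]
    have h1 := card_torsionBy_mul_card_smul_top (M := M) t
    have h2 := card_torsionBy_mul_card_smul_top (M := M) N
    rw [hker] at h1
    have hpos : 0 < Nat.card (N • (⊤ : Submodule R M) : Submodule R M) := Nat.card_pos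
    have hcard : Nat.card (t • (⊤ : Submodule R M) : Submodule R M) =
        Nat.card (Submodule.torsionBy R M N) := by
      apply Nat.eq_of_mul_eq_mul_left hpos
      rw [h1, ← h2, mul_comm]
    exact SetLike.coe_injective (Set.eq_of_subset_of_ncard_le hle hcard.ge (Set.toFinite _))
  have hN : ∀ m : M, N • m = 0 → ∃ n : M, t • n = m := fun m hm => by
    have : m ∈ t • (⊤ : Submodule R M) := by
      rw [him, Submodule.mem_torsionBy_iff, hm]
    obtain ⟨n, -, hn⟩ := (Submodule.mem_smul_pointwise_iff_exists _ _ _).mp this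
    exact ⟨n, hn⟩
  refine ⟨top_le_iff.mp ?_, hN⟩
  apply Submodule.le_of_le_sup_smul_of_isNilpotent
    (isNilpotent_sub_one_of_pow_prime_eq_one hp hR hx)
  intro m _
  obtain ⟨c, hc, hcm⟩ := hC (N • m) (by
    rw [← sub_eq_zero, ← mul_smul, ← sub_smul, ← sub_one_mul, htN, zero_smul])
  obtain ⟨n, hn⟩ := hN (m - c) (by rw [smul_sub, hcm, sub_self])
  rw [← add_sub_cancel c m, ← hn]
  exact Submodule.add_mem_sup hc (Submodule.smul_mem_pointwise_smul _ _ _ trivial)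

end Pointwise

/-! ### The product of the elements `y - x ^ j` -/

open Polynomial in
theorem exists_prod_X_sub_C_X_pow_eq {p : ℕ} (hp : p.Prime) :
    ∃ W : ℤ[X][X], ∏ j ∈ Finset.range p, (X - C (X ^ j) : ℤ[X][X]) =
      X ^ p - 1 + C (cyclotomic p ℤ) * W := by
  suffices h : C (cyclotomic p ℤ) ∣
      ∏ j ∈ Finset.range p, (X - C (X ^ j) : ℤ[X][X]) - (X ^ p - 1) by
    obtain ⟨W, hW⟩ := h
    exact ⟨W, by rw [← hW]; ring⟩
  obtain ⟨ζ, hζ⟩ : ∃ ζ : ℂ, IsPrimitiveRoot ζ p := ⟨_, Complex.isPrimitiveRoot_exp p hp.ne_zero⟩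
  have hmap : (∏ j ∈ Finset.range p, (X - C (X ^ j) : ℤ[X][X]) - (X ^ p - 1)).map
      (aeval ζ : ℤ[X] →ₐ[ℤ] ℂ).toRingHom = 0 := by
    have h1 : (X ^ p - 1 : ℂ[X]) = ∏ j ∈ Finset.range p, (X - C (ζ ^ j)) := by
      rw [X_pow_sub_one_eq_prod hp.pos hζ, nthRootsFinset_def, Finset.prod, Finset.prod,
        Multiset.toFinset_val, Multiset.dedup_eq_self.mpr hζ.nthRoots_one_nodup,
        hζ.nthRoots_eq (one_pow p)]
      simp
    simp [Polynomial.map_prod, Polynomial.map_sub, h1]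
  rw [C_dvd_iff_dvd_coeff]
  intro i
  rw [cyclotomic_eq_minpoly hζ hp.pos]
  apply minpoly.isIntegrallyClosed_dvd (hζ.isIntegral hp.pos)
  have := congrArg (fun f => coeff f i) hmap
  simpa only [coeff_map, coeff_zero] using! this

open Polynomial in
/-- Up to a unit, the product of the `p` elements `y - x ^ j` is `normElt p x * (y - 1)`.
Modulo the `p`-th cyclotomic polynomial in `x` the product is `y ^ p - 1`; the cofactor of that
polynomial can be computed at `x = 1`, where it is `((y - 1) ^ p - (y ^ p - 1)) / p`. -/
theorem prod_sub_pow_eq_normElt_mul_unit {R : Type*} [CommRing R] {p : ℕ} (hp : p.Prime)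
    (hR : IsNilpotent (p : R)) {x y : R} (hx : x ^ p = 1) (hy : y ^ p = 1) :
    ∃ u : R, IsUnit u ∧
      ∏ j ∈ Finset.range p, (y - x ^ j) = normElt p x * ((y - 1) * u) := by
  have := Fact.mk hp
  obtain ⟨W, hW⟩ := exists_prod_X_sub_C_X_pow_eq hp
  -- The specialisation of `W` at `x = 1`.
  set W₁ : ℤ[X] := W.map (evalRingHom 1) with hW₁
  have h1 : (X - 1 : ℤ[X]) ^ p = X ^ p - 1 + (p : ℤ[X]) * W₁ := by
    have := congrArg (Polynomial.map (evalRingHom (1 : ℤ))) hW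
    simpa [Polynomial.map_prod, eval_one_cyclotomic_prime] using this
  obtain ⟨r, hr⟩ := exists_add_pow_prime_eq hp (X - 1 : ℤ[X]) 1
  have hW₁r : W₁ = -((X - 1) * r) := by
    have hp0 : (p : ℤ[X]) ≠ 0 := by exact_mod_cast hp.ne_zero
    apply mul_left_cancel₀ hp0
    rw [sub_add_cancel, one_pow] at hr
    linear_combination -h1 - hr
  -- Dividing `hr` by `X - 1` and evaluating at `1` gives `r(1) = 1`.
  have hr1 : r.eval 1 = 1 := by
    have h2 : ∑ i ∈ Finset.range p, (X : ℤ[X]) ^ i = (X - 1) ^ (p - 1) + (p : ℤ[X]) * r := by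
      have hX : (X - 1 : ℤ[X]) ≠ 0 := X_sub_C_ne_zero 1
      apply mul_left_cancel₀ hX
      rw [mul_geom_sum, mul_add, ← pow_succ', Nat.sub_add_cancel hp.one_le]
      rw [sub_add_cancel, one_pow] at hr
      linear_combination hr
    have h3 := congrArg (eval 1) h2
    simp [eval_finsetSum, (Nat.sub_pos_of_lt hp.one_lt).ne'] at h3
    have hp0 : (p : ℤ) ≠ 0 := by exact_mod_cast hp.ne_zero
    apply mul_left_cancel₀ hp0
    linarith
  have hunit : IsUnit (aeval y r) := by
    obtain ⟨V, hV⟩ := (dvd_iff_isRoot (p := r - 1) (a := 1)).mpr (by simp [hr1])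
    have : aeval y r = 1 + (y - 1) * aeval y V := by
      have := congrArg (aeval y) hV
      simp at this
      linear_combination this
    rw [this]
    exact (Commute.isNilpotent_mul_right (Commute.all _ _)
      (isNilpotent_sub_one_of_pow_prime_eq_one hp hR hy)).isUnit_one_add
  refine ⟨-aeval y r, hunit.neg, ?_⟩
  have hev := congrArg (eval₂ (aeval x : ℤ[X] →ₐ[ℤ] R).toRingHom y) hW
  have hcyc : aeval x (cyclotomic p ℤ) = normElt p x := by
    simp [cyclotomic_prime, normElt]
  have hXj : ∀ j : ℕ, eval₂ (aeval x : ℤ[X] →ₐ[ℤ] R).toRingHom y (C (X ^ j)) = x ^ j := fun j => by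
    rw [eval₂_C]
    simp
  simp only [eval₂_finsetProd, eval₂_sub, eval₂_add, eval₂_mul, eval₂_pow, eval₂_X, eval₂_one,
    hXj, hy,
    sub_self, zero_add] at hev
  rw [eval₂_C] at hev
  change _ = aeval x (cyclotomic p ℤ) * _ at hev
  rw [hcyc] at hev
  rw [hev]
  -- `x` acts as `1` on multiples of `normElt p x`.
  have hdvd : x - 1 ∣ eval₂ (aeval x : ℤ[X] →ₐ[ℤ] R).toRingHom y W - aeval y W₁ := by
    rw [aeval_def, hW₁, eval₂_map, eval₂_eq_sum, eval₂_eq_sum, Polynomial.sum, Polynomial.sum,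
      ← Finset.sum_sub_distrib]
    refine Finset.dvd_sum fun i _ => ?_
    rw [← sub_mul]
    refine Dvd.dvd.mul_right ?_ _
    have := sub_dvd_eval_sub x 1 ((W.coeff i).map (Int.castRingHom R))
    simpa [aeval_def, Polynomial.eval_map, eval₂_at_one] using this
  obtain ⟨c, hc⟩ := hdvd
  have hW₁y : aeval y W₁ = -((y - 1) * aeval y r) := by simp [hW₁r]
  have := sub_one_mul_normElt hx
  linear_combination normElt p x * hc + c * this + normElt p x * hW₁y

/-! ### Modules whose fixed elements are norms -/

section CardBound
open scoped Pointwise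

variable {R : Type*} [CommRing R]

/-- The product of the norm elements of the members of a list. For a basis `l` of an elementary
abelian `p`-group this is the norm element of the whole group. -/
def listNorm (p : ℕ) (l : List R) : R := (l.map (normElt p)).prod

/-- Every element of `M` fixed by all members of `l` is a norm: for a basis `l` of an elementary
abelian `p`-group, this is the vanishing of the Tate cohomology of `M` in degree `0`. -/
def FixedAreNorms (p : ℕ) (l : List R) (M : Type*) [AddCommGroup M] [Module R M] : Prop :=
  ∀ m : M, (∀ x ∈ l, x • m = m) → ∃ n : M, listNorm p l • n = m

theorem mem_torsionBy_sub_one_iff {M : Type*} [AddCommGroup M] [Module R M] {x : R} {m : M} :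
    m ∈ Submodule.torsionBy R M (x - 1) ↔ x • m = m := by
  rw [Submodule.mem_torsionBy_iff, sub_smul, one_smul, sub_eq_zero]

theorem listNorm_cons_smul {M : Type*} [AddCommGroup M] [Module R M] (p : ℕ) (x : R) (l : List R)
    (m : M) : listNorm p (x :: l) • m = normElt p x • listNorm p l • m := by
  rw [← mul_smul]
  simp [listNorm]

theorem smul_listNorm_smul {M : Type*} [AddCommGroup M] [Module R M] {p : ℕ} {x : R} {l : List R}
    (hx : x ^ p = 1) (hxl : x ∈ l) (m : M) : x • listNorm p l • m = listNorm p l • m := by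
  obtain ⟨c, hc⟩ : normElt p x ∣ listNorm p l := List.dvd_prod (List.mem_map_of_mem hxl)
  rw [← mem_torsionBy_sub_one_iff, Submodule.mem_torsionBy_iff, ← mul_smul, hc, ← mul_assoc,
    sub_one_mul_normElt hx, zero_mul, zero_smul]

theorem FixedAreNorms.torsionBy {p : ℕ} {x : R} {l : List R} {M : Type*} [AddCommGroup M]
    [Module R M] (hx : x ^ p = 1) (h : FixedAreNorms p (x :: l) M) :
    FixedAreNorms p l (Submodule.torsionBy R M (x - 1)) := by
  intro m hm
  obtain ⟨n, hn⟩ := h m (by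
    intro z hz
    rcases List.mem_cons.mp hz with rfl | hz
    · exact mem_torsionBy_sub_one_iff.mp m.2
    · exact congrArg Subtype.val (hm z hz))
  refine ⟨⟨normElt p x • n, ?_⟩, ?_⟩
  · rw [Submodule.mem_torsionBy_iff, ← mul_smul, sub_one_mul_normElt hx, zero_smul]
  · ext
    rw [← hn, listNorm_cons_smul]
    exact smul_comm _ _ _

variable {M : Type*} [AddCommGroup M] [Module R M] {p : ℕ}

/-- A nontrivial finite module has nonzero elements fixed by any list of elements of order
dividing `p`. -/
theorem exists_ne_zero_forall_smul_eq (hp : p.Prime) (hR : IsNilpotent (p : R)) (l : List R)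
    (hl : ∀ x ∈ l, x ^ p = 1) (B : Submodule R M) (hB : B ≠ ⊥) :
    ∃ m ∈ B, m ≠ 0 ∧ ∀ x ∈ l, x • m = m := by
  induction l generalizing B with
  | nil => simpa using (Submodule.ne_bot_iff B).mp hB
  | cons x l ih =>
    obtain ⟨b, hb, hb0, hxb⟩ := exists_ne_zero_smul_eq_zero_of_isNilpotent
      (isNilpotent_sub_one_of_pow_prime_eq_one hp hR (hl x (by simp))) hB
    obtain ⟨m, hm, hm0, hml⟩ := ih (fun z hz => hl z (by simp [hz]))
      (B ⊓ Submodule.torsionBy R M (x - 1))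
      ((Submodule.ne_bot_iff _).mpr ⟨b, ⟨hb, (Submodule.mem_torsionBy_iff _ _).mpr hxb⟩, hb0⟩)
    refine ⟨m, hm.1, hm0, ?_⟩
    intro z hz
    rcases List.mem_cons.mp hz with rfl | hz
    · exact mem_torsionBy_sub_one_iff.mp hm.2
    · exact hml z hz

/-- If the fixed elements are norms, no member `x` of the list acts trivially on the norms of the
other members: otherwise `normElt p x` acts on these norms as multiplication by `p`,
so that the fixed elements are contained in a nilpotent multiple of themselves. -/
theorem FixedAreNorms.exists_smul_listNorm_ne [Nontrivial M] (hp : p.Prime)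
    (hR : IsNilpotent (p : R)) {x : R} {l : List R} (hl : ∀ z ∈ x :: l, z ^ p = 1)
    (h : FixedAreNorms p (x :: l) M) :
    ∃ m : M, x • listNorm p l • m ≠ listNorm p l • m := by
  by_contra! hc
  set B : Submodule R M := listNorm p l • ⊤ with hB
  have hfix : ∀ m : M, (∀ z ∈ x :: l, z • m = m) → ∃ b ∈ B, (p : R) • b = m := by
    intro m hm
    obtain ⟨n, hn⟩ := h m hm
    refine ⟨listNorm p l • n, Submodule.smul_mem_pointwise_smul _ _ _ trivial, ?_⟩
    rw [← normElt_smul_of_smul_eq p (hc n), ← hn, listNorm_cons_smul]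
  have hlB : ∀ b ∈ B, ∀ z ∈ x :: l, z • b = b := by
    intro b hb z hz
    obtain ⟨n, -, rfl⟩ := (Submodule.mem_smul_pointwise_iff_exists _ _ _).mp hb
    rcases List.mem_cons.mp hz with rfl | hz'
    · exact hc n
    · exact smul_listNorm_smul (hl z hz) hz' n
  have hbot : B = ⊥ := Submodule.eq_bot_of_le_smul_of_isNilpotent hR fun b hb => by
    obtain ⟨c, hcB, rfl⟩ := hfix b (hlB b hb)
    exact Submodule.smul_mem_pointwise_smul _ _ _ hcB
  obtain ⟨m, -, hm0, hm⟩ := exists_ne_zero_forall_smul_eq (M := M) hp hR (x :: l) hl ⊤ top_ne_bot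
  obtain ⟨b, hb, rfl⟩ := hfix m hm
  rw [hbot, Submodule.mem_bot] at hb
  exact hm0 (by rw [hb, smul_zero])

theorem card_ge_sq_of_smul_ne [Finite M] [Fact p.Prime] (hR : IsNilpotent (p : R)) {x : R}
    (hx : x ^ p = 1) {B : Submodule R M} {b : M} (hb : b ∈ B) (h : x • b ≠ b) :
    p ^ 2 ≤ Nat.card B := by
  have ht := isNilpotent_sub_one_of_pow_prime_eq_one Fact.out hR hx
  have hsB : (x - 1) • B ≠ ⊥ := Submodule.smul_ne_bot_iff.mpr
    ⟨b, hb, by rwa [sub_smul, one_smul, sub_ne_zero]⟩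
  have h1 := Submodule.prime_mul_card_le_of_lt hR (bot_lt_iff_ne_bot.mpr hsB)
  have h2 := Submodule.prime_mul_card_le_of_lt hR
    (Submodule.smul_lt_of_isNilpotent ht fun h0 : B = ⊥ => hsB (by rw [h0, Submodule.smul_bot']))
  rw [Nat.card_unique, mul_one] at h1
  rw [sq]
  exact (Nat.mul_le_mul_left p h1).trans h2

/-- If the product of `n` nilpotent elements does not kill `B`, then multiplying `B` by one of them
after the other divides the order by at least `p` each time. -/
theorem Submodule.pow_mul_card_le [Finite M] [Fact p.Prime] (hR : IsNilpotent (p : R))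
    (f : ℕ → R) (n : ℕ) (hf : ∀ j < n, IsNilpotent (f j)) (B : Submodule R M)
    (h : (∏ j ∈ Finset.range n, f j) • B ≠ ⊥) :
    p ^ n * Nat.card ((∏ j ∈ Finset.range n, f j) • B : Submodule R M) ≤ Nat.card B := by
  induction n with
  | zero => simp
  | succ n ih =>
    rw [Finset.prod_range_succ, mul_comm _ (f n), mul_smul] at h ⊢
    have hne : (∏ j ∈ Finset.range n, f j) • B ≠ ⊥ := fun h0 => h (by rw [h0, Submodule.smul_bot'])
    have h1 := Submodule.prime_mul_card_le_of_lt hR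
      (Submodule.smul_lt_of_isNilpotent (hf n n.lt_succ_self) hne)
    have h2 := ih (fun j hj => hf j (hj.trans n.lt_succ_self)) hne
    rw [pow_succ, mul_assoc]
    exact (Nat.mul_le_mul_left _ h1).trans h2

/-- The case of rank two. The chain of submodules cut out by the partial products of the elements
`y - x ^ j` does not reach zero, and its first step has order at least `p ^ 2`. -/
theorem FixedAreNorms.card_ge_of_pair [Finite M] [Nontrivial M] [Fact p.Prime]
    (hR : IsNilpotent (p : R)) {x y : R} (hx : x ^ p = 1) (hy : y ^ p = 1)
    (h : FixedAreNorms p [x, y] M) : p ^ (p + 2) ≤ Nat.card M := by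
  have hp : p.Prime := Fact.out
  have h' : FixedAreNorms p [y, x] M := fun m hm => by
    simpa [listNorm, mul_comm] using h m (by simpa [and_comm] using hm)
  obtain ⟨u, hu, hprod⟩ := prod_sub_pow_eq_normElt_mul_unit hp hR hx hy
  -- The first step of the chain.
  have hfirst : p ^ 2 ≤ Nat.card (Submodule.torsionBy R M (y - 1)) := by
    obtain ⟨m, hm⟩ := h.exists_smul_listNorm_ne hp hR (by simp [hx, hy])
    refine card_ge_sq_of_smul_ne hR hx (b := listNorm p [y] • m) ?_ hm
    rw [Submodule.mem_torsionBy_iff, ← mul_smul]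
    simp [listNorm, sub_one_mul_normElt hy]
  have hcard := card_torsionBy_mul_card_smul_top (M := M) (y - 1)
  -- The product of all the `y - x ^ j` does not kill `M`.
  have hne : (∏ j ∈ Finset.range p, (y - x ^ j)) • (⊤ : Submodule R M) ≠ ⊥ := by
    rw [Submodule.smul_ne_bot_iff]
    obtain ⟨m, hm⟩ := h'.exists_smul_listNorm_ne hp hR (by simp [hx, hy])
    refine ⟨m, trivial, fun h0 => hm ?_⟩
    rw [hprod, ← mul_assoc, mul_comm, mul_smul] at h0
    have h1 := (hu.smul_eq_zero).mp h0
    rw [← mem_torsionBy_sub_one_iff, Submodule.mem_torsionBy_iff, ← mul_smul, mul_comm]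
    simpa [listNorm] using h1
  obtain ⟨q, hq⟩ : ∃ q, p = q + 1 := ⟨p - 1, (Nat.sub_add_cancel hp.one_le).symm⟩
  have hnil : ∀ j < q, IsNilpotent (y - x ^ (j + 1)) := by
    intro j _
    have hz : (y * x ^ ((p - 1) * (j + 1))) ^ p = 1 := by
      rw [mul_pow, hy, ← pow_mul, mul_comm _ p, pow_mul, hx, one_pow, one_mul]
    have hyz : y - x ^ (j + 1) = x ^ (j + 1) * (y * x ^ ((p - 1) * (j + 1)) - 1) := by
      have : x ^ (j + 1) * x ^ ((p - 1) * (j + 1)) = 1 := by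
        rw [← pow_add, ← one_add_mul, Nat.add_sub_cancel' hp.one_le, pow_mul,
          hx, one_pow]
      linear_combination -y * this
    rw [hyz]
    exact (Commute.all _ _).isNilpotent_mul_left
      (isNilpotent_sub_one_of_pow_prime_eq_one hp hR hz)
  have hsplit : (∏ j ∈ Finset.range p, (y - x ^ j)) • (⊤ : Submodule R M) =
      (∏ j ∈ Finset.range q, (y - x ^ (j + 1))) • (y - 1) • (⊤ : Submodule R M) := by
    nth_rewrite 1 [hq]
    rw [Finset.prod_range_succ', pow_zero, mul_smul]
  rw [hsplit] at hne
  have hchain := Submodule.pow_mul_card_le hR (fun j => y - x ^ (j + 1)) q hnil _ hne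
  have hlast := Submodule.prime_mul_card_le_of_lt hR (bot_lt_iff_ne_bot.mpr hne)
  rw [Nat.card_unique, mul_one] at hlast
  have hD : p ^ p ≤ Nat.card ((y - 1) • (⊤ : Submodule R M) : Submodule R M) := by
    nth_rewrite 2 [hq]
    rw [pow_succ]
    exact (Nat.mul_le_mul_left _ hlast).trans hchain
  rw [← hcard, pow_add, mul_comm]
  exact Nat.mul_le_mul hfirst hD

/-- The lower bound on the order of a module with vanishing Tate cohomology in degree `0`, from
rank two by passing to the invariants of one element at a time. -/
theorem FixedAreNorms.card_ge (M : Type*) [AddCommGroup M] [Module R M]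
    [Finite M] [Nontrivial M] [Fact p.Prime] (hR : IsNilpotent (p : R))
    {l : List R} (hl : ∀ x ∈ l, x ^ p = 1) (hlen : 2 ≤ l.length) (h : FixedAreNorms p l M) :
    p ^ (l.length + p) ≤ Nat.card M := by
  have hp : p.Prime := Fact.out
  induction l generalizing M with
  | nil => simp at hlen
  | cons x l ih =>
    rcases Nat.lt_or_ge l.length 2 with h2 | h2
    · have h1 : l.length = 1 := by simp at hlen; omega
      obtain ⟨y, rfl⟩ := List.length_eq_one_iff.mp h1
      have := h.card_ge_of_pair hR (hl x (by simp)) (hl y (by simp))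
      simpa [add_comm] using this
    · have hx := hl x (by simp)
      set B := Submodule.torsionBy R M (x - 1) with hB
      have hBne : B ≠ ⊥ := by
        obtain ⟨b, -, hb0, hb⟩ := exists_ne_zero_smul_eq_zero_of_isNilpotent (M := M)
          (isNilpotent_sub_one_of_pow_prime_eq_one hp hR hx) top_ne_bot
        exact (Submodule.ne_bot_iff _).mpr ⟨b, (Submodule.mem_torsionBy_iff _ _).mpr hb, hb0⟩
      have : Nontrivial B := (Submodule.nontrivial_iff_ne_bot).mpr hBne
      have hBlt : B < ⊤ := by
        rw [lt_top_iff_ne_top]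
        intro htop
        obtain ⟨m, hm⟩ := h.exists_smul_listNorm_ne hp hR hl
        have hmem : listNorm p l • m ∈ B := htop ▸ trivial
        rw [hB, Submodule.mem_torsionBy_iff, sub_smul, one_smul, sub_eq_zero] at hmem
        exact hm hmem
      have h3 := ih B (fun z hz => hl z (by simp [hz])) h2 (h.torsionBy hx)
      have h4 := Submodule.prime_mul_card_le_of_lt hR hBlt
      rw [Nat.card_congr Submodule.topEquiv.toEquiv] at h4
      rw [List.length_cons, add_right_comm, pow_succ']
      exact (Nat.mul_le_mul_left p h3).trans h4

/-- The submodule of elements fixed by all members of a list. -/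
def fixedSubmodule (l : List R) (M : Type*) [AddCommGroup M] [Module R M] : Submodule R M where
  carrier := {m | ∀ x ∈ l, x • m = m}
  add_mem' ha hb x hx := by rw [smul_add, ha x hx, hb x hx]
  zero_mem' x _ := smul_zero x
  smul_mem' c m hm x hx := by rw [smul_comm, hm x hx]

/-- The vanishing property descends to smaller lists. -/
theorem FixedAreNorms.of_cons [Finite M] (hp : p.Prime) (hR : IsNilpotent (p : R)) {x : R}
    {l : List R} (hl : ∀ z ∈ x :: l, z ^ p = 1) (h : FixedAreNorms p (x :: l) M) :
    FixedAreNorms p l M := by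
  intro m hm
  set C : Submodule R (fixedSubmodule l M) :=
    (listNorm p l • (⊤ : Submodule R M)).comap (fixedSubmodule l M).subtype with hC
  have htop : C = ⊤ := by
    refine (eq_top_and_mem_smul_of_norm_surjOn hp hR (hl x (by simp)) (C := C) ?_).1
    rintro ⟨b, hb⟩ hxb
    obtain ⟨n, hn⟩ := h b (by
      intro z hz
      rcases List.mem_cons.mp hz with rfl | hz
      · exact congrArg Subtype.val hxb
      · exact hb z hz)
    have hmem : listNorm p l • n ∈ fixedSubmodule l M := fun z hz =>
      smul_listNorm_smul (hl z (by simp [hz])) hz n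
    refine ⟨⟨_, hmem⟩, Submodule.smul_mem_pointwise_smul _ _ _ trivial, ?_⟩
    exact Subtype.ext ((listNorm_cons_smul p x l n).symm.trans hn)
  have hmC : (⟨m, hm⟩ : fixedSubmodule l M) ∈ C := htop ▸ trivial
  obtain ⟨n, -, hn⟩ := (Submodule.mem_smul_pointwise_iff_exists _ _ _).mp
    (Submodule.mem_comap.mp hmC)
  exact ⟨n, hn⟩

/-- Descent to a single member `x` of the list: fixed elements are norms, elements of norm zero
are in the image of `x - 1`, and `x` acts nontrivially. -/
theorem FixedAreNorms.exists_singleton [Finite M] [Nontrivial M] (hp : p.Prime)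
    (hR : IsNilpotent (p : R)) {l : List R} (hl : ∀ z ∈ l, z ^ p = 1) (hne : l ≠ [])
    (h : FixedAreNorms p l M) :
    ∃ x ∈ l, (∀ m : M, x • m = m → ∃ n : M, normElt p x • n = m) ∧
      (∀ m : M, normElt p x • m = 0 → ∃ n : M, x • n - n = m) ∧ ∃ m : M, x • m ≠ m := by
  induction l with
  | nil => exact absurd rfl hne
  | cons x l ih =>
    rcases eq_or_ne l [] with rfl | hl0
    · have h1 : ∀ m : M, x • m = m → ∃ n : M, normElt p x • n = m := fun m hm => by
        simpa [listNorm] using h m (by simpa using hm)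
      refine ⟨x, by simp, h1, fun m hm => ?_, ?_⟩
      · obtain ⟨n, hn⟩ := (eq_top_and_mem_smul_of_norm_surjOn hp hR (hl x (by simp)) (C := ⊤)
          fun m hm => by simpa using h1 m hm).2 m hm
        exact ⟨n, by rw [← hn, sub_smul, one_smul]⟩
      · obtain ⟨m, hm⟩ := h.exists_smul_listNorm_ne hp hR hl
        exact ⟨_, hm⟩
    · obtain ⟨z, hz, hrest⟩ := ih (fun z hz => hl z (by simp [hz])) hl0 (h.of_cons hp hR hl)
      exact ⟨z, by simp [hz], hrest⟩

end CardBound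

/-! ### Representations of elementary abelian `p`-groups -/

/-- A finite elementary abelian `p`-group has a basis `l`: its length is the rank, it generates
the group, and the sum of all group elements in any commutative ring factors as the product of
the norm elements of the members of `l`. -/
theorem exists_list_basis {p : ℕ} [Fact p.Prime] {Q : Type*} [CommGroup Q] [Fintype Q]
    (hpow : ∀ q : Q, q ^ p = 1) :
    ∃ l : List Q, Nat.card Q = p ^ l.length ∧ Subgroup.closure {x | x ∈ l} = ⊤ ∧
      ∀ (R : Type u) [CommRing R] (f : Q →* R), ∑ g : Q, f g = listNorm p (l.map f) := by
  have : Module (ZMod p) (Additive Q) := AddCommGroup.zmodModule fun x => hpow x.toMul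
  have hp : p.Prime := Fact.out
  have : Module.Finite (ZMod p) (Additive Q) := Module.Finite.of_finite
  let d := Module.finrank (ZMod p) (Additive Q)
  let b : Module.Basis (Fin d) (ZMod p) (Additive Q) := Module.finBasis (ZMod p) (Additive Q)
  let x : Fin d → Q := fun i => (b i).toMul
  have hrepr : ∀ c : Fin d → ZMod p,
      (b.equivFun.symm c).toMul = ∏ i, x i ^ (c i).val := by
    intro c
    rw [Module.Basis.equivFun_symm_apply, toMul_sum]
    refine Finset.prod_congr rfl fun i _ => ?_
    conv_lhs => rw [← ZMod.natCast_zmod_val (c i), Nat.cast_smul_eq_nsmul]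
    rfl
  refine ⟨List.ofFn x, ?_, ?_, ?_⟩
  · have : Nat.card (Additive Q) = p ^ d := by
      rw [Module.natCard_eq_pow_finrank (K := ZMod p), Nat.card_zmod]
    simpa using this
  · rw [eq_top_iff]
    intro g _
    obtain ⟨c, hc⟩ := b.equivFun.symm.surjective (Additive.ofMul g)
    have : g = ∏ i, x i ^ (c i).val := by rw [← hrepr, hc]; rfl
    rw [this]
    exact Subgroup.prod_mem _ fun i _ => Subgroup.pow_mem _
      (Subgroup.subset_closure (by simp [List.mem_ofFn])) _
  · intro R _ f
    have hnorm : ∀ z : R, ∑ j : ZMod p, z ^ j.val = normElt p z := fun z => by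
      rw [normElt]
      refine Finset.sum_nbij ZMod.val (fun j _ => Finset.mem_range.mpr j.val_lt)
        (fun i _ j _ h => ZMod.val_injective p h) (fun i hi => ?_) fun _ _ => rfl
      exact ⟨i, by simp, ZMod.val_cast_of_lt (Finset.mem_range.mp hi)⟩
    have h1 : ∑ g : Q, f g = ∑ c : Fin d → ZMod p, ∏ i, f (x i) ^ (c i).val := by
      symm
      refine Fintype.sum_equiv (b.equivFun.symm.toEquiv.trans Additive.toMul) _ _ fun c => ?_
      change _ = f (b.equivFun.symm c).toMul
      rw [hrepr, map_prod]
      simp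
    rw [h1, listNorm, List.map_ofFn, List.map_ofFn, List.prod_ofFn]
    have h2 := Finset.prod_univ_sum (fun _ : Fin d => (Finset.univ : Finset (ZMod p)))
      (fun i j => f (x i) ^ j.val)
    rw [Fintype.piFinset_univ] at h2
    rw [← h2]
    exact Finset.prod_congr rfl fun i _ => hnorm _

/-- The consequences of `FixedAreNorms` for a representation of a finite elementary abelian
`p`-group `Q` on a finite `p`-group `A`. The representation is viewed as a module over the
commutative ring of endomorphisms generated by `Q`, in which `p` is nilpotent. -/
theorem Representation.consequences_of_fixed_are_norms {p : ℕ} [Fact p.Prime] {k Q A : Type u}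
    [CommRing k] [CommGroup Q] [Fintype Q] [AddCommGroup A] [Module k A] [Finite A] [Nontrivial A]
    (hpow : ∀ q : Q, q ^ p = 1) (hA : IsPGroup p (Multiplicative A)) (ρ : Representation k Q A)
    (h : ∀ a : A, (∀ g, ρ g a = a) → ∃ b : A, ∑ g, ρ g b = a) :
    ∃ l : List Q, Nat.card Q = p ^ l.length ∧ Subgroup.closure {x | x ∈ l} = ⊤ ∧
      (2 ≤ l.length → p ^ (l.length + p) ≤ Nat.card A) ∧
      (l ≠ [] → ∃ q : Q,
        (∀ a : A, ρ q a = a → ∃ b : A, ∑ i ∈ Finset.range p, ρ (q ^ i) b = a) ∧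
        (∀ a : A, ∑ i ∈ Finset.range p, ρ (q ^ i) a = 0 → ∃ b : A, ρ q b - b = a) ∧
        ∃ a : A, ρ q a ≠ a) := by
  have hp : p.Prime := Fact.out
  obtain ⟨l, hcard, hgen, hsum⟩ := exists_list_basis (p := p) hpow
  have hcomm : IsMulCommutative (Algebra.adjoin k (Set.range ρ)) :=
    Algebra.isMulCommutative_adjoin k (by
      rintro _ ⟨a, rfl⟩ _ ⟨b, rfl⟩
      rw [← map_mul, ← map_mul, mul_comm])
  let R := Algebra.adjoin k (Set.range ρ)
  let f : Q →* R := ρ.codRestrict R fun q => Algebra.subset_adjoin ⟨q, rfl⟩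
  have hf : ∀ (q : Q) (a : A), f q • a = ρ q a := fun _ _ => rfl
  have hR : IsNilpotent (p : R) := by
    obtain ⟨n, hn⟩ := IsPGroup.iff_card.mp hA
    refine ⟨n, ?_⟩
    ext a
    have h0 : p ^ n • a = 0 := by
      have := pow_card_eq_one' (x := Multiplicative.ofAdd a)
      rw [hn] at this
      exact this
    have h1 : (p : R) ^ n • a = 0 := by
      rw [← Nat.cast_pow, Nat.cast_smul_eq_nsmul, h0]
    exact h1
  have hl : ∀ z ∈ l.map f, z ^ p = 1 := by
    intro z hz
    obtain ⟨q, -, rfl⟩ := List.mem_map.mp hz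
    rw [← map_pow, hpow, map_one]
  have hnorms : FixedAreNorms p (l.map f) A := by
    intro a ha
    have hfix : ∀ g : Q, ρ g a = a := fun g => by
      have hg : g ∈ Subgroup.closure {x | x ∈ l} := hgen ▸ Subgroup.mem_top g
      induction hg using Subgroup.closure_induction with
      | mem x hx => exact ha _ (List.mem_map_of_mem hx)
      | one => simp
      | mul x y _ _ hx hy => rw [map_mul, Module.End.mul_apply, hy, hx]
      | inv x _ hx =>
        conv_lhs => rw [← hx]
        rw [← Module.End.mul_apply, ← map_mul, inv_mul_cancel, map_one, Module.End.one_apply]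
    obtain ⟨b, hb⟩ := h a hfix
    refine ⟨b, ?_⟩
    rw [← hsum R f, Finset.sum_smul, ← hb]
    rfl
  have hnq : ∀ (q : Q) (a : A),
      normElt p (f q) • a = ∑ i ∈ Finset.range p, ρ (q ^ i) a := fun q a => by
    rw [normElt, Finset.sum_smul]
    refine Finset.sum_congr rfl fun i _ => ?_
    rw [← map_pow, hf]
  refine ⟨l, hcard, hgen, fun h2 => ?_, fun hne => ?_⟩
  · have := hnorms.card_ge A hR hl (by simpa using h2)
    simpa using this
  · obtain ⟨z, hz, h1, h2, a, ha⟩ := hnorms.exists_singleton hp hR hl (by simpa using hne)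
    obtain ⟨q, -, rfl⟩ := List.mem_map.mp hz
    refine ⟨q, fun a ha => ?_, fun a ha => ?_, a, ha⟩
    · obtain ⟨b, hb⟩ := h1 a ha
      exact ⟨b, by rw [← hnq, hb]⟩
    · exact h2 a (by rw [hnq, ha])

/-! ### The Frattini subgroup of a finite `p`-group -/

section Frattini

variable {p : ℕ} [Fact p.Prime] {G : Type u} [Group G]

theorem IsPGroup.coatom_normal [Finite G] (hG : IsPGroup p G) {M : Subgroup G} (hM : IsCoatom M) :
    M.Normal :=
  have := hG.isNilpotent
  Subgroup.NormalizerCondition.normal_of_coatom M Group.normalizerCondition_of_isNilpotent hM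

theorem Subgroup.zpowers_sup_eq_top_of_isCoatom {M : Subgroup G} (hM : IsCoatom M)
    {g : G} (hg : g ∉ M) : Subgroup.zpowers g ⊔ M = ⊤ :=
  hM.2 _ (lt_of_le_of_ne le_sup_right fun h => hg (by
    rw [h]; exact Subgroup.mem_sup_left (Subgroup.mem_zpowers g)))

theorem QuotientGroup.mem_zpowers_mk_of_isCoatom {M : Subgroup G} [M.Normal] (hM : IsCoatom M)
    {g : G} (hg : g ∉ M) (q : G ⧸ M) : q ∈ Subgroup.zpowers (g : G ⧸ M) := by
  obtain ⟨h, rfl⟩ := QuotientGroup.mk_surjective q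
  have hh : h ∈ Subgroup.zpowers g ⊔ M := Subgroup.zpowers_sup_eq_top_of_isCoatom hM hg ▸ trivial
  obtain ⟨y, hy, m, hm, rfl⟩ := Subgroup.mem_sup_of_normal_right.mp hh
  obtain ⟨n, rfl⟩ := hy
  refine ⟨n, ?_⟩
  simp [(QuotientGroup.eq_one_iff m).mpr hm]

theorem IsPGroup.commutator_mem_frattini [Finite G] (hG : IsPGroup p G) (a b : G) :
    a * b * a⁻¹ * b⁻¹ ∈ frattini G := by
  simp only [frattini, Order.radical, Subgroup.mem_iInf]
  intro M hM
  have := hG.coatom_normal hM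
  by_cases ha : a ∈ M
  · have := (hG.coatom_normal hM).conj_mem _ (M.inv_mem ha) b
    simpa [mul_assoc] using M.mul_mem ha this
  · obtain ⟨n, hn⟩ := QuotientGroup.mem_zpowers_mk_of_isCoatom hM ha (b : G ⧸ M)
    rw [← QuotientGroup.eq_one_iff]
    simp only [QuotientGroup.mk_mul, QuotientGroup.mk_inv, ← hn]
    group

theorem IsPGroup.pow_mem_frattini [Finite G] (hG : IsPGroup p G) (a : G) : a ^ p ∈ frattini G := by
  simp only [frattini, Order.radical, Subgroup.mem_iInf]
  intro M hM
  have := hG.coatom_normal hM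
  by_contra ha
  -- Modulo `M`, `a` would be a power of `a ^ p`, hence of all `a ^ (p ^ j)`, and so trivial.
  obtain ⟨n, hn⟩ := QuotientGroup.mem_zpowers_mk_of_isCoatom hM ha (a : G ⧸ M)
  obtain ⟨k, hk⟩ := hG a
  have hiter : ∀ j : ℕ, (a : G ⧸ M) = (a : G ⧸ M) ^ ((p ^ j : ℤ) * n ^ j) := fun j => by
    induction j with
    | zero => simp
    | succ j ih =>
      have h1 : (a : G ⧸ M) = (a : G ⧸ M) ^ ((p : ℤ) * n) := by
        conv_lhs => rw [← hn]
        simp [zpow_mul]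
      conv_lhs => rw [ih, h1]
      rw [← zpow_mul]
      congr 1
      ring
  have h1 : (a : G ⧸ M) = 1 := by
    rw [hiter k, zpow_mul]
    have : (a : G ⧸ M) ^ (p ^ k : ℤ) = 1 := by
      have := congrArg (QuotientGroup.mk : G → G ⧸ M) hk
      simpa [← zpow_natCast] using this
    rw [this, one_zpow]
  exact ha (M.pow_mem ((QuotientGroup.eq_one_iff a).mp h1) p)

theorem centerFrattiniRep_mk_apply (x : G) (a : Additive (Subgroup.center (frattini G))) :
    (((centerFrattiniRep G (x : G ⧸ frattini G) a).toMul : frattini G) : G) =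
      x * ((a.toMul : frattini G) : G) * x⁻¹ :=
  conjCenterFrattini_apply G x a.toMul

/-- In terms of the group, `(a x) ^ n = (a · ˣa ⋯ ˣ⁽ⁿ⁻¹⁾a) x ^ n`. -/
theorem coe_sum_centerFrattiniRep_mul_pow (x : G) (a : Additive (Subgroup.center (frattini G)))
    (n : ℕ) :
    (((∑ i ∈ Finset.range n, centerFrattiniRep G ((x : G ⧸ frattini G) ^ i) a).toMul :
      frattini G) : G) * x ^ n = (((a.toMul : frattini G) : G) * x) ^ n := by
  induction n with
  | zero => simp
  | succ n ih =>
    rw [Finset.sum_range_succ, toMul_add, Subgroup.coe_mul, Subgroup.coe_mul, pow_succ (_ * x),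
      ← ih, ← QuotientGroup.mk_pow, centerFrattiniRep_mk_apply]
    group

/-- If the Frattini subgroup is abelian, it is not possible that an element `q` of the Frattini
quotient acts nontrivially with vanishing `Ĥ⁰` and `Ĥ⁻¹`: a lift of `q` can be chosen of order `p`
because `Ĥ⁰ = 0`; because `Ĥ⁻¹ = 0`, the Frattini subgroup acts transitively on the conjugates of
this lift, so that its centralizer supplements the Frattini subgroup and is the whole group. -/
theorem IsPGroup.frattini_not_commutative [Finite G] (hG : IsPGroup p G) (q : G ⧸ frattini G)
    (h0 : ∀ a, centerFrattiniRep G q a = a →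
      ∃ b, ∑ i ∈ Finset.range p, centerFrattiniRep G (q ^ i) b = a)
    (h1 : ∀ a, ∑ i ∈ Finset.range p, centerFrattiniRep G (q ^ i) a = 0 →
      ∃ b, centerFrattiniRep G q b - b = a)
    (h2 : ∃ a, centerFrattiniRep G q a ≠ a) :
    ¬ ∀ a b : frattini G, a * b = b * a := by
  intro hcomm
  -- Elements of the Frattini subgroup, regarded as elements of its center.
  have lift : ∀ c ∈ frattini G, ∃ a : Additive (Subgroup.center (frattini G)),
      ((a.toMul : frattini G) : G) = c := fun c hc =>
    ⟨Additive.ofMul ⟨⟨c, hc⟩, Subgroup.mem_center_iff.mpr fun b => hcomm b ⟨c, hc⟩⟩, rfl⟩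
  have inj : ∀ a b : Additive (Subgroup.center (frattini G)),
      ((a.toMul : frattini G) : G) = ((b.toMul : frattini G) : G) → a = b := fun a b hab =>
    Additive.toMul.injective (Subtype.ext (Subtype.ext hab))
  obtain ⟨x, rfl⟩ := QuotientGroup.mk_surjective q
  -- A lift `w` of `q` with `w ^ p = 1`.
  obtain ⟨w, hw, hwp⟩ : ∃ w : G, (w : G ⧸ frattini G) = x ∧ w ^ p = 1 := by
    obtain ⟨c, hc⟩ := lift (x ^ p)⁻¹ ((frattini G).inv_mem (hG.pow_mem_frattini x))
    obtain ⟨b, hb⟩ := h0 c (inj _ _ (by rw [centerFrattiniRep_mk_apply, hc]; group))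
    refine ⟨((b.toMul : frattini G) : G) * x, ?_, ?_⟩
    · rw [QuotientGroup.mk_mul, (QuotientGroup.eq_one_iff _).mpr (b.toMul : frattini G).2, one_mul]
    · rw [← coe_sum_centerFrattiniRep_mul_pow, hb, hc, inv_mul_cancel]
  rw [← hw] at h1 h2
  have hsup : Subgroup.centralizer {w} ⊔ frattini G = ⊤ := by
    rw [eq_top_iff]
    intro g _
    obtain ⟨c, hc⟩ := lift _ (hG.commutator_mem_frattini g w)
    obtain ⟨b, hb⟩ := h1 c (inj _ _ (by
      have h3 := coe_sum_centerFrattiniRep_mul_pow w c p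
      have h4 : ((c.toMul : frattini G) : G) * w = g * w * g⁻¹ := by rw [hc]; group
      rw [h4, conj_pow, hwp, mul_one, mul_one, mul_inv_cancel] at h3
      rw [h3]
      rfl))
    set v : G := ((b.toMul : frattini G) : G) with hv
    have hvΦ : v ∈ frattini G := (b.toMul : frattini G).2
    have hcv : g * w * g⁻¹ * w⁻¹ = v⁻¹ * (w * v * w⁻¹) := by
      rw [← hc, ← hb, sub_eq_neg_add, toMul_add, Subgroup.coe_mul, Subgroup.coe_mul,
        centerFrattiniRep_mk_apply]
      rfl
    have hmem : v * g ∈ Subgroup.centralizer {w} := by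
      rw [Subgroup.mem_centralizer_singleton_iff]
      have h5 : g * w = v⁻¹ * (w * v * w⁻¹) * w * g := by rw [← hcv]; group
      rw [mul_assoc, h5]
      group
    have : g = v⁻¹ * (v * g) := by group
    rw [this]
    exact Subgroup.mul_mem _ (Subgroup.mem_sup_right ((frattini G).inv_mem hvΦ))
      (Subgroup.mem_sup_left hmem)
  have htop := frattini_nongenerating hsup
  obtain ⟨a, ha⟩ := h2
  refine ha (inj _ _ ?_)
  have hca : ((a.toMul : frattini G) : G) ∈ Subgroup.centralizer {w} := htop ▸ Subgroup.mem_top _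
  rw [Subgroup.mem_centralizer_singleton_iff] at hca
  rw [centerFrattiniRep_mk_apply, ← hca]
  group

/-- A nonabelian `p`-group has center of index at least `p ^ 2`. -/
theorem IsPGroup.sq_mul_card_center_le {P : Type*} [Group P] [Finite P] (hP : IsPGroup p P)
    (h : ¬ ∀ a b : P, a * b = b * a) : p ^ 2 * Nat.card (Subgroup.center P) ≤ Nat.card P := by
  rw [Subgroup.card_eq_card_quotient_mul_card_subgroup (Subgroup.center P)]
  refine Nat.mul_le_mul_right _ ?_
  obtain ⟨n, hn⟩ := IsPGroup.iff_card.mp (hP.to_quotient (Subgroup.center P))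
  rw [hn]
  refine Nat.pow_le_pow_right (Fact.out : p.Prime).pos ?_
  by_contra! hlt
  apply h
  have hcyc : IsCyclic (P ⧸ Subgroup.center P) := by
    interval_cases n
    · have := (Nat.card_eq_one_iff_unique.mp (by simpa using hn)).1
      exact isCyclic_of_subsingleton
    · exact isCyclic_of_prime_card (by simpa using hn)
  have := (QuotientGroup.mk' (Subgroup.center P)).isMulCommutative_of_isCyclic_of_ker_le_center
    (by simp)
  exact mul_comm'

/-- The order of the Frattini subgroup `Φ` when every element of `Z(Φ)` fixed by `G` is a norm. -/
theorem IsPGroup.card_frattini_ge [Finite G] [Fintype (G ⧸ frattini G)] (hG : IsPGroup p G)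
    (hnc : ∃ a b : G, a * b ≠ b * a)
    (h : ∀ a, (∀ g, centerFrattiniRep G g a = a) → ∃ b, ∑ g, centerFrattiniRep G g b = a) :
    ∃ d, 2 ≤ d ∧ Group.rank G ≤ d ∧ Nat.card (G ⧸ frattini G) = p ^ d ∧
      p ^ (d + p + 2) ≤ Nat.card (frattini G) := by
  have hcommQ : ∀ a b : G ⧸ frattini G, a * b = b * a := by
    intro a b
    obtain ⟨a, rfl⟩ := QuotientGroup.mk_surjective a
    obtain ⟨b, rfl⟩ := QuotientGroup.mk_surjective b
    have := (QuotientGroup.eq_one_iff _).mpr (hG.commutator_mem_frattini a b)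
    rwa [QuotientGroup.mk_mul, QuotientGroup.mk_mul, QuotientGroup.mk_mul, QuotientGroup.mk_inv,
      QuotientGroup.mk_inv, mul_inv_eq_one, mul_inv_eq_iff_eq_mul] at this
  have hpow : ∀ q : G ⧸ frattini G, q ^ p = 1 := by
    intro q
    obtain ⟨a, rfl⟩ := QuotientGroup.mk_surjective q
    exact (QuotientGroup.eq_one_iff _).mpr (hG.pow_mem_frattini a)
  have hΦ : IsPGroup p (frattini G) := hG.to_subgroup _
  have hΦne : Nontrivial (frattini G) := by
    obtain ⟨a, b, hab⟩ := hnc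
    refine ⟨⟨⟨_, hG.commutator_mem_frattini a b⟩, 1, fun h1 => hab ?_⟩⟩
    have := congrArg Subtype.val h1
    simpa [mul_inv_eq_iff_eq_mul, mul_inv_eq_one] using this
  have hZne : Nontrivial (Additive (Subgroup.center (frattini G))) := hΦ.center_nontrivial
  have hZ : IsPGroup p (Multiplicative (Additive (Subgroup.center (frattini G)))) :=
    hΦ.to_subgroup _
  let _ : CommGroup (G ⧸ frattini G) :=
    { (inferInstance : Group (G ⧸ frattini G)) with mul_comm := hcommQ }
  obtain ⟨l, hcard, hgen, hbound, hq⟩ :=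
    Representation.consequences_of_fixed_are_norms hpow hZ (centerFrattiniRep G) h
  -- Lifts of a basis of the Frattini quotient generate the group.
  obtain ⟨s, hs⟩ : ∃ s : G ⧸ frattini G → G, ∀ q, (s q : G ⧸ frattini G) = q :=
    ⟨Quotient.out, QuotientGroup.out_eq'⟩
  have hgenG : Subgroup.closure {x | x ∈ l.map s} = ⊤ := by
    apply frattini_nongenerating
    rw [eq_top_iff]
    intro g _
    have hle : (⊤ : Subgroup (G ⧸ frattini G)) ≤
        (Subgroup.closure {x | x ∈ l.map s}).map (QuotientGroup.mk' (frattini G)) := by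
      rw [← hgen, Subgroup.closure_le]
      intro q hql
      exact ⟨s q, Subgroup.subset_closure (List.mem_map_of_mem hql), hs q⟩
    obtain ⟨y, hy, hyg⟩ := hle (Subgroup.mem_top (g : G ⧸ frattini G))
    have : g = y * (y⁻¹ * g) := by group
    rw [this]
    exact Subgroup.mul_mem_sup hy (QuotientGroup.eq.mp hyg)
  have hl2 : 2 ≤ l.length := by
    by_contra! hlt
    obtain ⟨a, b, hab⟩ := hnc
    have hcl : ∀ g : G, g ∈ Subgroup.closure {x | x ∈ l.map s} := fun g =>
      hgenG ▸ Subgroup.mem_top g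
    have : ∃ x : G, ∀ g : G, g ∈ Subgroup.zpowers x := by
      rcases l with _ | ⟨x, _ | ⟨y, l⟩⟩
      · exact ⟨1, fun g => by simpa using hcl g⟩
      · exact ⟨s x, fun g => by simpa [Subgroup.zpowers_eq_closure] using hcl g⟩
      · simp at hlt
    obtain ⟨x, hx⟩ := this
    obtain ⟨i, rfl⟩ := hx a
    obtain ⟨j, rfl⟩ := hx b
    exact hab (Commute.zpow_zpow_self x i j)
  refine ⟨l.length, hl2, ?_, hcard, ?_⟩
  · classical
    have := Group.rank_le (G := G) (S := (l.map s).toFinset) (by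
      rw [← hgenG]
      congr 1
      ext
      simp)
    exact this.trans ((List.toFinset_card_le _).trans (by simp))
  · obtain ⟨q, h0, h1, h2⟩ := hq (by rintro rfl; simp at hl2)
    have hΦnc := hG.frattini_not_commutative q h0 h1 h2
    have := hΦ.sq_mul_card_center_le hΦnc
    refine le_trans ?_ this
    rw [pow_add, mul_comm]
    exact Nat.mul_le_mul_left _ (hbound hl2)

end Frattini

/-! ### Tate cohomology and the bounds for NS-groups -/

/-- The vanishing of Tate cohomology in degree `0` means that invariants are norms: the Tate complex
is exact at `0`, where an invariant is a cocycle and the incoming differential is the norm. -/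
theorem exists_norm_eq_of_subsingleton_tateCohomology_zero {k Q : Type u} [CommRing k] [Group Q]
    [Fintype Q] (M : Rep k Q) (h : Subsingleton (tateCohomology M 0)) (m : M)
    (hm : ∀ g : Q, M.ρ g m = m) : ∃ n : M, ∑ g : Q, M.ρ g n = m := by
  have hex : (tateComplex M).ExactAt 0 := by
    rw [HomologicalComplex.exactAt_iff_isZero_homology]
    exact (ModuleCat.isZero_of_iff_subsingleton).mpr h
  rw [HomologicalComplex.exactAt_iff' _ (-1) 0 1 (by simp) (by simp),
    CategoryTheory.ShortComplex.moduleCat_exact_iff] at hex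
  obtain ⟨y, hy⟩ := hex (fun _ : Fin 0 → Q => m) (by
    change (groupCohomology.inhomogeneousCochains M).d 0 1 _ = 0
    rw [groupCohomology.inhomogeneousCochains.d_def]
    ext g
    simp [inhomogeneousCochains.d_hom_apply, hm]
    rfl)
  change M.tateNorm _ = _ at hy
  rw [Rep.tateNorm_eq] at hy
  obtain ⟨z, rfl⟩ : ∃ z : (Fin 0 → Q) →₀ M, z = y := ⟨y, rfl⟩
  refine ⟨z default, Eq.trans ?_ (congrFun hy default)⟩
  change _ = (Finsupp.lsum k (fun _ : Fin 0 → Q => LinearMap.pi fun _ : Fin 0 → Q => M.ρ.norm)) z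
    default
  simp [Finsupp.sum_fintype, Representation.norm]

/-- An NS-group satisfies the hypothesis that fixed elements are norms. -/
theorem IsNSGroup.exists_norm_eq {p : ℕ} {G : Type u} [Group G] [Finite G]
    [hQ : Fintype (G ⧸ frattini G)] (h : IsNSGroup p G)
    (a : Additive (Subgroup.center (frattini G))) (ha : ∀ g, centerFrattiniRep G g a = a) :
    ∃ b, ∑ g, centerFrattiniRep G g b = a := by
  have hsub : Subsingleton (tateZero G) := by
    rw [← not_nontrivial_iff_subsingleton]
    exact fun hn => h.2.2 ⟨h.1, h.2.1, hn⟩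
  have key := exists_norm_eq_of_subsingleton_tateCohomology_zero
    (Rep.of (centerFrattiniRep G)) (by
      obtain rfl : hQ = Fintype.ofFinite _ := Subsingleton.elim _ _
      exact hsub) a ha
  exact key

theorem mainTheorem1 (p : ℕ) [Fact p.Prime] (G : Type u) [Group G] [Finite G] :
    (∀ m : ℕ, IsNSGroup p G → Group.rank G = m →
      p ^ (m + p + 2) ≤ Nat.card (frattini G) ∧ p ^ (2 * m + p + 2) ≤ Nat.card G) ∧
    (IsPGroup p G → (∃ a b : G, a * b ≠ b * a) →
      (Nat.card (frattini G) < p ^ (p + 4) ∨ Nat.card G < p ^ (p + 6)) → IsSGroup p G) := by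
  have hpos : 0 < p := (Fact.out : p.Prime).pos
  -- Both parts follow from bounds in terms of the rank `d` of the Frattini quotient.
  have main : IsNSGroup p G → ∃ d, 2 ≤ d ∧ Group.rank G ≤ d ∧
      p ^ (d + p + 2) ≤ Nat.card (frattini G) ∧ p ^ (2 * d + p + 2) ≤ Nat.card G := by
    intro h
    have : Fintype (G ⧸ frattini G) := Fintype.ofFinite _
    obtain ⟨d, hd2, hrank, hcard, hΦ⟩ := h.1.card_frattini_ge h.2.1 h.exists_norm_eq
    refine ⟨d, hd2, hrank, hΦ, ?_⟩
    rw [Subgroup.card_eq_card_quotient_mul_card_subgroup (frattini G), hcard,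
      show 2 * d + p + 2 = d + (d + p + 2) by omega, pow_add]
    exact Nat.mul_le_mul_left _ hΦ
  refine ⟨?_, fun hG hnc hsmall => ?_⟩
  · rintro m h rfl
    obtain ⟨d, -, hrank, h1, h2⟩ := main h
    exact ⟨(Nat.pow_le_pow_right hpos (by omega)).trans h1,
      (Nat.pow_le_pow_right hpos (by omega)).trans h2⟩
  · by_contra hS
    obtain ⟨d, hd2, -, h1, h2⟩ := main ⟨hG, hnc, hS⟩
    rcases hsmall with hs | hs
    · exact absurd ((Nat.pow_le_pow_right hpos (by omega)).trans h1) (not_le.mpr hs)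
    · exact absurd ((Nat.pow_le_pow_right hpos (by omega)).trans h2) (not_le.mpr hs)
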